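/- Let $b(n)$ be the number of partitions of the non-negative integer $n$ into powers of $2$ (with $b(0)=1$), and for $m\ge 1$ let $b_m(n)=\sum_{i_1+\cdots+i_m=n}b(i_1)\cdots b(i_m)$, the sum being over non-negative integers $i_1,\dots,i_m$. Let $S_m$ be the set of all $n\in\mathbb{N}=\{0,1,2,\dots\}$ such that $b_m(n)$ is not of the form $x^2+y^2+z^2$ with $x,y,z\in\mathbb{Z}$, and for real $x\ge 0$ let $S_m(x)=\#\{n\in S_m:\ n\le x\}$. Theorem. Let $k\ge 3$ be an integer. Then for all real $x\ge 2^k$, $$\left|S_{2^k-1}(x)-\frac{x}{6}\right|\le\frac{2^{k-2}}{3}\left(\log_2 x-k+26\right).$$ In particular, the natural density of $S_{2^k-1}$ in $\mathbb{N}$ exists and equals $$\lim_{x\to+\infty}\frac{S_{2^k-1}(x)}{x}=\frac16 .$$ Moreover, there are strictly increasing sequences $(m_l)_{l\in\mathbb{N}},(n_l)_{l\in\mathbb{N}}$ of non-negative integers such that, as $l\to\infty$, $$S_{2^k-1}(m_l)-\frac{m_l}{6}\sim\frac{2^{k-2}}{3}\log_2 m_l,\qquad S_{2^k-1}(n_l)-\frac{n_l}{6}\sim-\frac{2^{k-2}}{3}\log_2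 n_l;$$ explicitly, one can take $m_0=n_0=0$, $m_{l+1}=16m_l+5\cdot 2^{k+1}$ and $n_{l+1}=16n_l+10\cdot 2^{k+1}$. -/

import Mathlib

open Filter Topology Asymptotics

/-- The binary partition function: the number of partitions of `n` all of whose parts are
powers of two. -/
noncomputable def binaryPartition (n : ℕ) : ℕ :=
  open Classical in (Nat.Partition.restricted n (fun i => ∃ j : ℕ, i = 2 ^ j)).card

/-- The `m`-colored binary partition function: the `m`-fold convolution
`∑ b(i₁) ⋯ b(iₘ)` over all `(i₁, …, iₘ)` in `ℕᵐ` with `i₁ + ⋯ + iₘ = n`. -/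
noncomputable def coloredBinaryPartition (m n : ℕ) : ℕ :=
  ∑ i ∈ Finset.piAntidiag (Finset.univ : Finset (Fin m)) n, ∏ j, binaryPartition (i j)

/-- The set of `n` for which `b_m(n)` is not a sum of three squares of integers. -/
def notSumThreeSquares (m : ℕ) : Set ℕ :=
  {n | ¬ ∃ x y z : ℤ, (coloredBinaryPartition m n : ℤ) = x ^ 2 + y ^ 2 + z ^ 2}

/-- The counting function of `notSumThreeSquares m`: the number of its elements `n ≤ x`. -/
noncomputable def countNotSumThreeSquares (m : ℕ) (x : ℝ) : ℕ :=
  {n : ℕ | n ∈ notSumThreeSquares m ∧ (n : ℝ) ≤ x}.ncard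

/-! Let `B` be the generating function of `b` and `T = ∏ (1 - X^(2^j))` that of the Thue–Morse signs
`t`. Then `B T = 1`, so `B^(2^k-1) = B^(2^k) T`. With `k = i + 3`, modulo 32 the power `B^(2^k)` is
`(1 + X^(2^i))^8 + 16 Q` for a polynomial `Q` of degree at most `2^k` with `Q(1)` even. Since `t =
±1`, the term `16 Q T` vanishes modulo 32 from index `2^k` on, and `b_{2^k-1}(n)` becomes a binomial
combination of nine Thue–Morse signs.

For `n = 2^k (a+1) + r` with `r < 2^k` this gives `-4 t(n)` modulo 32 if `t(a+1) = t(a)`, and 2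
modulo 4 otherwise. Numbers that are 2 modulo 4 or 4 modulo 32 are sums of three squares, those that
are 28 modulo 32 are not. Only the classes 2 mod 4 and 1 mod 8 of the three-square theorem are
needed; they follow from Dirichlet's theorem on primes and the reduction of ternary forms.

So a block of length `2^k` contains `2^(k-1)` exceptions if `t(a+1) = t(a)` and none otherwise. If
`R(A)` counts such repetitions, then `R(2A) = R(2A+1) = A - R(A)`. Hence `D(A) = 3 R(A) - A` changes
by 0, -1, 1, 0 when the base-4 digit 0, 1, 2, 3 is appended to `A`. The main term is `x/6`, the
error is essentially `2^(k-1)/3 · D`, at most the number of base-4 digits in size, and strings of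
digits 2 or 1 are extremal. -/

/-! ### Sums of three squares -/

/-- Reduction of a positive definite binary form `A u² + 2 B u v + C v²`: some primitive vector
`(p, q)`, completed to a basis, has a value of size at most `√(4 D / 3)`. -/
theorem exists_reduced_binary_form (A B C : ℤ) (hA : 0 < A) (hD : 0 < A * C - B ^ 2) :
    ∃ p q r s : ℤ, p * s - q * r = 1 ∧
      3 * (A * p ^ 2 + 2 * B * p * q + C * q ^ 2) ^ 2 ≤ 4 * (A * C - B ^ 2) := by
  induction hn : A.toNat using Nat.strong_induction_on generalizing A B C with
  | _ n ih =>
  -- Gauss reduction: translate until `|2 B'| ≤ A`; then stop if `A ≤ C'`, otherwise swap the two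
  -- variables and descend to the smaller leading coefficient `C'`.
  obtain ⟨l, hl₁, hl₂⟩ : ∃ l : ℤ, -A ≤ 2 * (B + l * A) ∧ 2 * (B + l * A) ≤ A := by
    refine ⟨-((2 * B + A) / (2 * A)), ?_, ?_⟩ <;>
      nlinarith [Int.mul_ediv_add_emod (2 * B + A) (2 * A),
        Int.emod_nonneg (2 * B + A) (by omega : 2 * A ≠ 0),
        Int.emod_lt_of_pos (2 * B + A) (by omega : 0 < 2 * A)]
  set B' := B + l * A with hB'
  set C' := C + 2 * B * l + l ^ 2 * A with hC'
  have hdisc : A * C' - B' ^ 2 = A * C - B ^ 2 := by rw [hB', hC']; ring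
  have hBsq : 4 * B' ^ 2 ≤ A ^ 2 := by nlinarith
  have hCpos : 0 < C' := by
    by_contra h
    nlinarith [sq_nonneg B']
  rcases le_or_gt A C' with h | h
  · refine ⟨1, 0, 0, 1, by ring, ?_⟩
    nlinarith
  · obtain ⟨p, q, r, s, h₁, h₂⟩ :=
      ih C'.toNat (by omega) C' B' A hCpos (by linarith [mul_comm A C']) rfl
    refine ⟨q + l * p, p, -(s + l * r), -r, by linear_combination h₁, ?_⟩
    have e : A * (q + l * p) ^ 2 + 2 * B * (q + l * p) * p + C * p ^ 2
        = C' * p ^ 2 + 2 * B' * p * q + A * q ^ 2 := by rw [hB', hC']; ring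
    rw [e]
    linarith [mul_comm A C']

theorem binary_form_pos (A B C : ℤ) (hA : 0 < A) (hD : 0 < A * C - B ^ 2) (p q : ℤ)
    (h : p ≠ 0 ∨ q ≠ 0) : 0 < A * p ^ 2 + 2 * B * p * q + C * q ^ 2 := by
  have hAG : A * (A * p ^ 2 + 2 * B * p * q + C * q ^ 2) =
      (A * p + B * q) ^ 2 + (A * C - B ^ 2) * q ^ 2 := by ring
  refine pos_of_mul_pos_right (a := A) ?_ hA.le
  rw [hAG]
  by_cases hq : q = 0
  · have hp : p ≠ 0 := by tauto
    subst hq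
    have : A * p ≠ 0 := mul_ne_zero hA.ne' hp
    simp only [mul_zero, add_zero]
    positivity
  · have := sq_nonneg (A * p + B * q)
    positivity

theorem ne_zero_or_ne_zero_of_det_eq_one {p q r s : ℤ} (h : p * s - q * r = 1) :
    p ≠ 0 ∨ q ≠ 0 := by
  by_contra! hpq
  simp [hpq.1, hpq.2] at h

/-- The descent step for ternary forms. If `b ≥ a`, then `a² ≤ G + a²/4`, so `3a² ≤ 4G`; with `3G² ≤
4a` this gives `27a³ ≤ 64`, impossible for `a ≥ 2`. -/
theorem reduced_coeff_lt {a b f G : ℤ} (ha : 2 ≤ a) (hG : 0 < G) (hb : a * b - f ^ 2 = G)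
    (hf₁ : -a ≤ 2 * f) (hf₂ : 2 * f ≤ a) (h : 3 * G ^ 2 ≤ 4 * a) : 0 < b ∧ b < a := by
  have hfsq : 4 * f ^ 2 ≤ a ^ 2 := by nlinarith only [hf₁, hf₂]
  constructor
  · by_contra hb0
    have h0 : a * b ≤ 0 := mul_nonpos_of_nonneg_of_nonpos (by omega) (not_lt.mp hb0)
    linarith [sq_nonneg f]
  · by_contra hba
    have h0 : a * a ≤ a * b := mul_le_mul_of_nonneg_left (not_lt.mp hba) (by omega)
    have h3 : 3 * a ^ 2 ≤ 4 * G := by linarith [sq a]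
    have h4 : (3 * a ^ 2) ^ 2 ≤ (4 * G) ^ 2 := pow_le_pow_left₀ (by positivity) h3 2
    have h5 : 2 * a ≤ a ^ 2 := by nlinarith only [ha]
    have h6 : (2 * a) ^ 2 ≤ (a ^ 2) ^ 2 := pow_le_pow_left₀ (by omega) h5 2
    linarith

/-- For determinant one the reduced value satisfies `3G² ≤ 4`, so `G = 1`, and completing the square
in the new basis leaves `(u + H v)² + v²`. -/
theorem binary_form_sum_two_sq (A B C : ℤ) (hA : 0 < A) (hD : A * C - B ^ 2 = 1) (y z : ℤ) :
    ∃ v w : ℤ, A * y ^ 2 + 2 * B * y * z + C * z ^ 2 = v ^ 2 + w ^ 2 := by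
  obtain ⟨p, q, r, s, h₁, h₂⟩ := exists_reduced_binary_form A B C hA (by omega)
  set G := A * p ^ 2 + 2 * B * p * q + C * q ^ 2 with hG
  have hG0 : 0 < G := binary_form_pos A B C hA (by omega) p q (ne_zero_or_ne_zero_of_det_eq_one h₁)
  have hG1 : G = 1 := by nlinarith
  set H := A * p * r + B * (p * s + q * r) + C * q * s with hH
  set K := A * r ^ 2 + 2 * B * r * s + C * s ^ 2 with hK
  have hdet : K - H ^ 2 = 1 := by
    have : G * K - H ^ 2 = (A * C - B ^ 2) * (p * s - q * r) ^ 2 := by rw [hG, hH, hK]; ring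
    rw [hG1, hD, h₁] at this
    linarith
  have hform : ∀ u v : ℤ, A * (p * u + r * v) ^ 2 + 2 * B * (p * u + r * v) * (q * u + s * v) +
      C * (q * u + s * v) ^ 2 = (u + H * v) ^ 2 + v ^ 2 := by
    intro u v
    have : A * (p * u + r * v) ^ 2 + 2 * B * (p * u + r * v) * (q * u + s * v) +
      C * (q * u + s * v) ^ 2 = G * u ^ 2 + 2 * H * u * v + K * v ^ 2 := by rw [hG, hH, hK]; ring
    rw [this, hG1]
    linear_combination v ^ 2 * hdet
  refine ⟨(s * y - r * z) + H * (p * z - q * y), p * z - q * y, ?_⟩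
  rw [← hform]
  have hy : p * (s * y - r * z) + r * (p * z - q * y) = y := by linear_combination y * h₁
  have hz : q * (s * y - r * z) + s * (p * z - q * y) = z := by linear_combination z * h₁
  rw [hy, hz]

/-- A positive definite integral ternary form of determinant one only takes values that are sums
of three squares. -/
theorem ternary_form_sum_three_sq (a b c d e f : ℤ) (ha : 0 < a) (hab : 0 < a * b - f ^ 2)
    (hdet : a * b * c + 2 * d * e * f - a * d ^ 2 - b * e ^ 2 - c * f ^ 2 = 1) (x y z : ℤ) :
    ∃ u v w : ℤ, a * x ^ 2 + b * y ^ 2 + c * z ^ 2 + 2 * d * y * z + 2 * e * x * z + 2 * f * x * y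
      = u ^ 2 + v ^ 2 + w ^ 2 := by
  induction hn : a.toNat using Nat.strong_induction_on generalizing a b c d e f x y z with
  | _ n ih =>
  by_cases ha1 : a = 1
  · subst ha1
    obtain ⟨v, w, h⟩ := binary_form_sum_two_sq (1 * b - f ^ 2) (d - e * f) (c - e ^ 2) hab
      (by linear_combination hdet) y z
    exact ⟨x + f * y + e * z, v, w, by linear_combination h⟩
  have ha2 : 2 ≤ a := by omega
  -- Multiplying the form by `a` and splitting off `(a x + f y + e z)²` leaves a binary form in `y,
  -- z` of determinant `a`. A small value `G` of it yields a vector whose ternary value `b'` is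
  -- below `a`.
  have hdisc : (a * b - f ^ 2) * (a * c - e ^ 2) - (a * d - e * f) ^ 2 = a := by
    linear_combination a * hdet
  obtain ⟨p, q, r, s, h₁, h₂⟩ := exists_reduced_binary_form (a * b - f ^ 2) (a * d - e * f)
    (a * c - e ^ 2) hab (by omega)
  rw [hdisc] at h₂
  set G := (a * b - f ^ 2) * p ^ 2 + 2 * (a * d - e * f) * p * q + (a * c - e ^ 2) * q ^ 2 with hG
  have hG0 : 0 < G := binary_form_pos _ _ _ hab (by omega) p q (ne_zero_or_ne_zero_of_det_eq_one h₁)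
  -- the form in the basis `(1, 0, 0)`, `(l, p, q)`, `(0, r, s)`
  obtain ⟨l, hl₁, hl₂⟩ : ∃ l : ℤ, -a ≤ 2 * (f * p + e * q + l * a) ∧
      2 * (f * p + e * q + l * a) ≤ a := by
    refine ⟨-((2 * (f * p + e * q) + a) / (2 * a)), ?_, ?_⟩ <;>
      nlinarith [Int.mul_ediv_add_emod (2 * (f * p + e * q) + a) (2 * a),
        Int.emod_nonneg (2 * (f * p + e * q) + a) (by omega : 2 * a ≠ 0),
        Int.emod_lt_of_pos (2 * (f * p + e * q) + a) (by omega : 0 < 2 * a)]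
  obtain ⟨f', hf'⟩ : ∃ t, t = f * p + e * q + l * a := ⟨_, rfl⟩
  rw [← hf'] at hl₁ hl₂
  obtain ⟨b', hb'⟩ : ∃ t, t =
    b * p ^ 2 + c * q ^ 2 + 2 * d * p * q + 2 * l * (f * p + e * q) + a * l ^ 2 := ⟨_, rfl⟩
  obtain ⟨e', he'⟩ : ∃ t, t = f * r + e * s := ⟨_, rfl⟩
  obtain ⟨d', hd'⟩ : ∃ t, t =
    b * p * r + c * q * s + d * (p * s + q * r) + l * (f * r + e * s) := ⟨_, rfl⟩
  obtain ⟨c', hc'⟩ : ∃ t, t = b * r ^ 2 + c * s ^ 2 + 2 * d * r * s := ⟨_, rfl⟩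
  have hGb : a * b' - f' ^ 2 = G := by rw [hb', hf', hG]; ring
  obtain ⟨hb0, hba⟩ := reduced_coeff_lt ha2 hG0 hGb hl₁ hl₂ h₂
  have hdet' : b' * a * c' + 2 * e' * d' * f' - b' * e' ^ 2 - a * d' ^ 2 - c' * f' ^ 2 = 1 := by
    have : b' * a * c' + 2 * e' * d' * f' - b' * e' ^ 2 - a * d' ^ 2 - c' * f' ^ 2 =
      (a * b * c + 2 * d * e * f - a * d ^ 2 - b * e ^ 2 - c * f ^ 2) * (p * s - q * r) ^ 2 := by
      rw [hb', hf', he', hd', hc']; ring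
    rw [this, hdet, h₁]; norm_num
  -- The first two basis vectors are swapped, so that `b'` becomes the leading coefficient.
  obtain ⟨u, v, w, h⟩ := ih b'.toNat (by omega) b' a c' e' d' f' hb0
    (by linarith [mul_comm a b']) hdet' (s * y - r * z) (x - l * (s * y - r * z)) (p * z - q * y) rfl
  refine ⟨u, v, w, ?_⟩
  rw [← h]
  have hy : p * (s * y - r * z) + r * (p * z - q * y) = y := by linear_combination y * h₁
  have hz : q * (s * y - r * z) + s * (p * z - q * y) = z := by linear_combination z * h₁
  generalize s * y - r * z = Y at *
  generalize p * z - q * y = Z at *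
  subst hy hz
  rw [hb', hf', he', hd', hc']; ring

/-- The criterion of Dirichlet and Landau for sums of three squares. -/
theorem sum_three_sq_of_neg_isSquare (n d t : ℤ) (hn : 2 ≤ n) (hd : 0 < d)
    (h : d * n - 1 ∣ t ^ 2 + d) : ∃ u v w : ℤ, n = u ^ 2 + v ^ 2 + w ^ 2 := by
  obtain ⟨a, ha⟩ := h
  have hpos : 0 < d * n - 1 := by nlinarith
  have ha0 : 0 < a := by
    by_contra hneg
    nlinarith [sq_nonneg t]
  -- Because `a (d n - 1) = t² + d`, this form has determinant one; its value at `(0, 0, 1)` is `n`.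
  obtain ⟨u, v, w, h⟩ := ternary_form_sum_three_sq a (d * n - 1) n 0 1 t ha0
    (by linarith [mul_comm a (d * n - 1)]) (by linear_combination (-n) * ha) 0 0 1
  exact ⟨u, v, w, by linear_combination h⟩

open NumberTheorySymbols in
theorem exists_prime_dvd_sq_add_of_jacobiSym {p d : ℕ} (hp : p.Prime) (hp4 : p % 4 = 1)
    (h : J(d | p) = 1) : ∃ t : ℤ, (p : ℤ) ∣ t ^ 2 + d := by
  have := Fact.mk hp
  have hodd : Odd p := Nat.odd_iff.mpr (by omega)
  have h1 : J(-(d : ℤ) | p) = 1 := by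
    rw [jacobiSym.neg _ hodd, h, ZMod.χ₄_nat_one_mod_four hp4, one_mul]
  obtain ⟨y, hy⟩ := ZMod.isSquare_of_jacobiSym_eq_one h1
  refine ⟨y.val, (ZMod.intCast_zmod_eq_zero_iff_dvd _ p).mp ?_⟩
  push_cast at hy ⊢
  rw [ZMod.natCast_zmod_val]
  linear_combination -hy

theorem sum_three_sq_of_mod_four_eq_two (n : ℕ) (hn : n % 4 = 2) :
    ∃ u v w : ℤ, (n : ℤ) = u ^ 2 + v ^ 2 + w ^ 2 := by
  obtain ⟨m, rfl⟩ : ∃ m, n = m + 1 := ⟨n - 1, by omega⟩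
  have hcop : m.Coprime (4 * (m + 1)) := by
    have h1 : m.Coprime (m + 1) := by simp
    have h2 : m.Coprime (2 ^ 2) :=
      Nat.Coprime.pow_right 2 (Nat.coprime_two_right.mpr (Nat.odd_iff.mpr (by omega)))
    exact Nat.Coprime.mul_right h2 h1
  -- Dirichlet gives a prime `p = d n - 1` with `d = 4j + 1`. Modulo `d` it is -1, so reciprocity
  -- makes `d`, and hence `-d`, a square modulo `p`.
  obtain ⟨p, hpn, hp, hmod⟩ := Nat.forall_exists_prime_gt_and_modEq m (by omega) hcop
  obtain ⟨j, hj⟩ := (Nat.modEq_iff_dvd' hpn.le).mp hmod.symm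
  have hpj : p = m + 4 * (m + 1) * j := by omega
  have hp4 : p % 4 = 1 := by
    rw [hpj, mul_assoc]; omega
  have hdvd : ((4 * j + 1 : ℕ) : ℤ) ∣ (p : ℤ) - (-1) := ⟨m + 1, by rw [hpj]; push_cast; ring⟩
  have hJ : jacobiSym ((4 * j + 1 : ℕ) : ℤ) p = 1 := by
    rw [jacobiSym.quadratic_reciprocity_one_mod_four (by omega) (Nat.odd_iff.mpr (by omega)),
      jacobiSym.mod_left' (a₂ := -1) (Int.emod_eq_emod_iff_emod_sub_eq_zero.mpr
          (Int.emod_eq_zero_of_dvd hdvd)),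
      jacobiSym.at_neg_one (Nat.odd_iff.mpr (by omega)), ZMod.χ₄_nat_one_mod_four (by omega)]
  obtain ⟨t, ht⟩ := exists_prime_dvd_sq_add_of_jacobiSym hp hp4 hJ
  refine sum_three_sq_of_neg_isSquare _ (4 * j + 1) t (by omega) (by positivity) ?_
  have e : (4 * j + 1 : ℤ) * (m + 1 : ℕ) - 1 = p := by rw [hpj]; push_cast; ring
  rw [e]
  exact_mod_cast ht

theorem sum_three_sq_of_mod_eight_eq_one (n : ℕ) (hn : n % 8 = 1) :
    ∃ u v w : ℤ, (n : ℤ) = u ^ 2 + v ^ 2 + w ^ 2 := by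
  obtain ⟨m, rfl⟩ : ∃ m, n = 8 * m + 1 := ⟨n / 8, by omega⟩
  rcases Nat.eq_zero_or_pos m with rfl | hm
  · exact ⟨1, 0, 0, by norm_num⟩
  have hcop : (12 * m + 1).Coprime (4 * (8 * m + 1)) := by
    have h1 : IsCoprime ((12 * m + 1 : ℕ) : ℤ) ((8 * m + 1 : ℕ) : ℤ) :=
      ⟨-2, 3, by push_cast; ring⟩
    have h2 : (12 * m + 1).Coprime (2 ^ 2) :=
      Nat.Coprime.pow_right 2 (Nat.coprime_two_right.mpr (Nat.odd_iff.mpr (by omega)))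
    exact Nat.Coprime.mul_right h2 (Nat.isCoprime_iff_coprime.mp h1)
  -- Here `2p = d n - 1` with `d = 8j + 3`. As `-2p` is 1 modulo `d` and -2 has Jacobi symbol 1
  -- modulo `d`, so has `p`.
  obtain ⟨p, hpn, hp, hmod⟩ := Nat.forall_exists_prime_gt_and_modEq (12 * m + 1) (by omega) hcop
  obtain ⟨j, hj⟩ := (Nat.modEq_iff_dvd' hpn.le).mp hmod.symm
  have hpj : p = 12 * m + 1 + 4 * (8 * m + 1) * j := by omega
  have hp4 : p % 4 = 1 := by
    rw [hpj, mul_assoc]; omega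
  have hodd : Odd (8 * j + 3) := Nat.odd_iff.mpr (by omega)
  have hdvd : ((8 * j + 3 : ℕ) : ℤ) ∣ (-2) * (p : ℤ) - 1 :=
    ⟨-(8 * m + 1), by rw [hpj]; push_cast; ring⟩
  have hJ : jacobiSym ((8 * j + 3 : ℕ) : ℤ) p = 1 := by
    rw [jacobiSym.quadratic_reciprocity_one_mod_four' hodd hp4]
    have h1 : jacobiSym (-2 * (p : ℤ)) (8 * j + 3) = 1 := by
      rw [jacobiSym.mod_left' (a₂ := 1) (Int.emod_eq_emod_iff_emod_sub_eq_zero.mpr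
          (Int.emod_eq_zero_of_dvd hdvd)), jacobiSym.one_left]
    rwa [jacobiSym.mul_left, jacobiSym.at_neg_two hodd, ZMod.χ₈'_nat_eq_if_mod_eight,
      if_neg (by omega), if_pos (by omega), one_mul] at h1
  obtain ⟨t, ht⟩ := exists_prime_dvd_sq_add_of_jacobiSym hp hp4 hJ
  -- The divisor needed is `2p`; an odd root, obtained by adding `p` if necessary, supplies the
  -- factor 2.
  obtain ⟨t', ht', hodd'⟩ : ∃ t : ℤ, (p : ℤ) ∣ t ^ 2 + (8 * j + 3 : ℕ) ∧ t % 2 = 1 := by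
    rcases Int.emod_two_eq_zero_or_one t with h | h
    · refine ⟨t + p, ?_, by omega⟩
      have : (t + p) ^ 2 + ((8 * j + 3 : ℕ) : ℤ) = t ^ 2 + (8 * j + 3 : ℕ) + p * (2 * t + p) := by
        ring
      rw [this]
      exact dvd_add ht (dvd_mul_right _ _)
    · exact ⟨t, ht, h⟩
  refine sum_three_sq_of_neg_isSquare _ (8 * j + 3) t' (by push_cast; omega) (by positivity) ?_
  have h2 : (2 : ℤ) ∣ t' ^ 2 + (8 * j + 3 : ℕ) := by
    obtain ⟨c, hc⟩ : ∃ c, t' = 2 * c + 1 := ⟨t' / 2, by omega⟩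
    exact ⟨2 * c ^ 2 + 2 * c + 4 * j + 2, by rw [hc]; push_cast; ring⟩
  have hcop2 : IsCoprime (2 : ℤ) (p : ℤ) := by
    refine ⟨-((p : ℤ) / 2), 1, ?_⟩
    omega
  have e : (8 * j + 3 : ℤ) * (8 * m + 1 : ℕ) - 1 = 2 * p := by rw [hpj]; push_cast; ring
  rw [e]
  exact_mod_cast hcop2.mul_dvd h2 ht'

/-- Divisibility by 4 forces all three squares to be even; dividing by 4 leaves 7 modulo 8, which is
no sum of three squares. -/
theorem not_sum_three_sq_of_emod_eq (n : ℤ) (hn : n % 32 = 28) :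
    ¬ ∃ x y z : ℤ, n = x ^ 2 + y ^ 2 + z ^ 2 := by
  rintro ⟨x, y, z, h⟩
  have key : ∀ a : ℤ, (∃ b, a = 2 * b ∧ a ^ 2 = 4 * b ^ 2) ∨ a ^ 2 % 4 = 1 := by
    intro a
    rcases Int.even_or_odd' a with ⟨b, hb | hb⟩
    · exact Or.inl ⟨b, hb, by rw [hb]; ring⟩
    · right; rw [hb]; ring_nf; omega
  have sq8 : ∀ a : ℤ, a ^ 2 % 8 = 0 ∨ a ^ 2 % 8 = 1 ∨ a ^ 2 % 8 = 4 := by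
    intro a
    have : a % 8 = 0 ∨ a % 8 = 1 ∨ a % 8 = 2 ∨ a % 8 = 3 ∨ a % 8 = 4 ∨ a % 8 = 5 ∨ a % 8 = 6 ∨
      a % 8 = 7 := by omega
    rcases this with h | h | h | h | h | h | h | h <;> simp [pow_two, Int.mul_emod, h]
  rcases key x with ⟨x', -, hx⟩ | hx <;> rcases key y with ⟨y', -, hy⟩ | hy <;>
    rcases key z with ⟨z', -, hz⟩ | hz <;> try omega
  have := sq8 x'
  have := sq8 y'
  have := sq8 z'
  omega

/-! ### The recurrence of the binary partition function -/

theorem binaryPartition_zero : binaryPartition 0 = 1 := by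
  classical
  unfold binaryPartition Nat.Partition.restricted
  rw [Finset.filter_true_of_mem, Finset.card_univ, Fintype.card_unique]
  intro p _
  simp

theorem card_restricted_filter_one_mem (n : ℕ) [DecidablePred fun i : ℕ => ∃ j : ℕ, i = 2 ^ j] :
    ((Nat.Partition.restricted (n + 1) (fun i => ∃ j : ℕ, i = 2 ^ j)).filter
      (fun p => 1 ∈ p.parts)).card =
    (Nat.Partition.restricted n (fun i => ∃ j : ℕ, i = 2 ^ j)).card := by
  symm
  refine Finset.card_bij (fun p _ => ⟨1 ::ₘ p.parts, ?_, ?_⟩) ?_ ?_ ?_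
  · intro i hi
    rcases Multiset.mem_cons.mp hi with rfl | hi
    · exact one_pos
    · exact p.parts_pos hi
  · rw [Multiset.sum_cons, p.parts_sum, add_comm]
  · intro p hp
    simp only [Nat.Partition.restricted, Finset.mem_filter, Finset.mem_univ, true_and,
      Multiset.mem_cons, true_or, and_true] at hp ⊢
    rintro i (rfl | hi)
    · exact ⟨0, rfl⟩
    · exact hp i hi
  · intro p _ q _ h
    ext1
    simpa using congrArg Nat.Partition.parts h
  · intro q hq
    simp only [Nat.Partition.restricted, Finset.mem_filter, Finset.mem_univ, true_and] at hq
    have hcons := Multiset.cons_erase hq.2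
    refine ⟨⟨q.parts.erase 1, fun hi => q.parts_pos (Multiset.mem_of_mem_erase hi), ?_⟩, ?_, ?_⟩
    · have := q.parts_sum
      rw [← hcons, Multiset.sum_cons] at this
      omega
    · simp only [Nat.Partition.restricted, Finset.mem_filter, Finset.mem_univ, true_and]
      exact fun i hi => hq.1 i (Multiset.mem_of_mem_erase hi)
    · ext1
      exact hcons

theorem card_restricted_filter_one_notMem (n : ℕ)
    [DecidablePred fun i : ℕ => ∃ j : ℕ, i = 2 ^ j] :
    ((Nat.Partition.restricted (2 * n) (fun i => ∃ j : ℕ, i = 2 ^ j)).filter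
      (fun p => ¬ 1 ∈ p.parts)).card =
    (Nat.Partition.restricted n (fun i => ∃ j : ℕ, i = 2 ^ j)).card := by
  symm
  refine Finset.card_bij (fun p _ => ⟨p.parts.map (2 * ·), ?_, ?_⟩) ?_ ?_ ?_
  · intro i hi
    obtain ⟨a, ha, rfl⟩ := Multiset.mem_map.mp hi
    have := p.parts_pos ha
    omega
  · rw [Multiset.sum_map_mul_left, Multiset.map_id', p.parts_sum]
  · intro p hp
    simp only [Nat.Partition.restricted, Finset.mem_filter, Finset.mem_univ, true_and,
      Multiset.mem_map] at hp ⊢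
    refine ⟨?_, ?_⟩
    · rintro i ⟨a, ha, rfl⟩
      obtain ⟨j, rfl⟩ := hp a ha
      exact ⟨j + 1, by ring⟩
    · rintro ⟨a, -, h⟩
      omega
  · intro p _ q _ h
    ext1
    exact Multiset.map_injective (fun a b h => by simpa using h) (congrArg Nat.Partition.parts h)
  · intro q hq
    simp only [Nat.Partition.restricted, Finset.mem_filter, Finset.mem_univ, true_and] at hq
    have heven : ∀ i ∈ q.parts, ∃ j, i = 2 * 2 ^ j := by
      intro i hi
      obtain ⟨j, rfl⟩ := hq.1 i hi
      cases j with
      | zero => exact absurd hi hq.2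
      | succ j => exact ⟨j, by ring⟩
    have hmap : (q.parts.map (· / 2)).map (2 * ·) = q.parts := by
      rw [Multiset.map_map]
      conv_rhs => rw [← Multiset.map_id q.parts]
      refine Multiset.map_congr rfl fun i hi => ?_
      obtain ⟨j, rfl⟩ := heven i hi
      simp
    refine ⟨⟨q.parts.map (· / 2), ?_, ?_⟩, ?_, ?_⟩
    · intro i hi
      obtain ⟨a, ha, rfl⟩ := Multiset.mem_map.mp hi
      obtain ⟨j, rfl⟩ := heven a ha
      simp
    · have := q.parts_sum
      rw [← hmap, Multiset.sum_map_mul_left, Multiset.map_id'] at this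
      omega
    · simp only [Nat.Partition.restricted, Finset.mem_filter, Finset.mem_univ, true_and,
        Multiset.mem_map]
      rintro i ⟨a, ha, rfl⟩
      obtain ⟨j, rfl⟩ := heven a ha
      exact ⟨j, by simp⟩
    · ext1
      exact hmap

theorem card_restricted_odd_filter_one_notMem (n : ℕ)
    [DecidablePred fun i : ℕ => ∃ j : ℕ, i = 2 ^ j] :
    ((Nat.Partition.restricted (2 * n + 1) (fun i => ∃ j : ℕ, i = 2 ^ j)).filter
      (fun p => ¬ 1 ∈ p.parts)).card = 0 := by
  rw [Finset.card_eq_zero, Finset.filter_eq_empty_iff]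
  intro q hq h1
  simp only [Nat.Partition.restricted, Finset.mem_filter, Finset.mem_univ, true_and] at hq
  have : 2 ∣ q.parts.sum := by
    refine Multiset.dvd_sum fun i hi => ?_
    obtain ⟨j, rfl⟩ := hq i hi
    cases j with
    | zero => exact absurd hi h1
    | succ j => exact ⟨2 ^ j, by ring⟩
  rw [q.parts_sum] at this
  omega

theorem binaryPartition_odd (n : ℕ) : binaryPartition (2 * n + 1) = binaryPartition (2 * n) := by
  classical
  unfold binaryPartition
  rw [← Finset.card_filter_add_card_filter_not (fun p => 1 ∈ p.parts),
    card_restricted_filter_one_mem, card_restricted_odd_filter_one_notMem, add_zero]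

theorem binaryPartition_even (n : ℕ) :
    binaryPartition (2 * n + 2) = binaryPartition (2 * n + 1) + binaryPartition (n + 1) := by
  classical
  unfold binaryPartition
  rw [← Finset.card_filter_add_card_filter_not (fun p => 1 ∈ p.parts),
    card_restricted_filter_one_mem, show 2 * n + 1 + 1 = 2 * (n + 1) by ring,
    card_restricted_filter_one_notMem]

/-! ### The Thue–Morse sign -/

/-- The Thue–Morse sequence with values `±1`. -/
def thueMorseSign (n : ℕ) : ℤ := (-1) ^ (Nat.digits 2 n).sum

theorem thueMorseSign_zero : thueMorseSign 0 = 1 := by simp [thueMorseSign]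

theorem thueMorseSign_two_mul (n : ℕ) : thueMorseSign (2 * n) = thueMorseSign n := by
  rcases Nat.eq_zero_or_pos n with rfl | h
  · simp
  · have := Nat.digits_add_two_add_one 0 (2 * n - 1)
    rw [zero_add, Nat.sub_add_cancel (by omega)] at this
    simp [thueMorseSign, this]

theorem thueMorseSign_two_mul_add_one (n : ℕ) :
    thueMorseSign (2 * n + 1) = -thueMorseSign n := by
  have := Nat.digits_add_two_add_one 0 (2 * n)
  have h2 : (2 * n + 1) / 2 = n := by omega
  have h3 : (2 * n + 1) % 2 = 1 := by omega
  rw [zero_add, h2, h3] at this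
  rw [thueMorseSign, this, List.sum_cons, pow_add, pow_one, neg_one_mul, thueMorseSign]

theorem thueMorseSign_eq (n : ℕ) : thueMorseSign n = 1 ∨ thueMorseSign n = -1 :=
  neg_one_pow_eq_or ℤ _

theorem thueMorseSign_pow_mul_add (j q r : ℕ) (hr : r < 2 ^ j) :
    thueMorseSign (2 ^ j * q + r) = thueMorseSign q * thueMorseSign r := by
  induction j generalizing r with
  | zero =>
    obtain rfl : r = 0 := by simpa using hr
    simp [thueMorseSign_zero]
  | succ j ih =>
    rcases Nat.even_or_odd' r with ⟨c, rfl | rfl⟩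
    · have : c < 2 ^ j := by rw [pow_succ] at hr; omega
      rw [show 2 ^ (j + 1) * q + 2 * c = 2 * (2 ^ j * q + c) by ring, thueMorseSign_two_mul,
        thueMorseSign_two_mul, ih c this]
    · have : c < 2 ^ j := by rw [pow_succ] at hr; omega
      rw [show 2 ^ (j + 1) * q + (2 * c + 1) = 2 * (2 ^ j * q + c) + 1 by ring,
        thueMorseSign_two_mul_add_one, thueMorseSign_two_mul_add_one, ih c this]
      ring

/-! ### Generating functions -/

section Series

open PowerSeries

/-- The generating function of the binary partition function. -/
noncomputable def binaryPartitionSeries : ℤ⟦X⟧ := PowerSeries.mk fun n => (binaryPartition n : ℤ)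

/-- The generating function of the Thue–Morse sequence. -/
noncomputable def thueMorseSeries : ℤ⟦X⟧ := PowerSeries.mk thueMorseSign

theorem coeff_thueMorseSeries (n : ℕ) : coeff n thueMorseSeries = thueMorseSign n :=
  coeff_mk _ _

theorem ext_parity {f g : ℤ⟦X⟧} (h0 : coeff 0 f = coeff 0 g)
    (h1 : ∀ n, coeff (2 * n + 1) f = coeff (2 * n + 1) g)
    (h2 : ∀ n, coeff (2 * n + 2) f = coeff (2 * n + 2) g) : f = g := by
  ext n
  rcases Nat.even_or_odd' n with ⟨c, rfl | rfl⟩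
  · cases c with
    | zero => exact h0
    | succ c => exact h2 c
  · exact h1 c

theorem coeff_expand_two_odd (f : ℤ⟦X⟧) (n : ℕ) :
    coeff (2 * n + 1) (expand 2 two_ne_zero f) = 0 :=
  coeff_expand_of_not_dvd 2 two_ne_zero f (by omega)

theorem coeff_expand_two_even (f : ℤ⟦X⟧) (n : ℕ) :
    coeff (2 * n + 2) (expand 2 two_ne_zero f) = coeff (n + 1) f :=
  coeff_expand_mul 2 two_ne_zero f (n + 1)

theorem coeff_expand_two_zero (f : ℤ⟦X⟧) : coeff 0 (expand 2 two_ne_zero f) = coeff 0 f :=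
  coeff_expand_mul 2 two_ne_zero f 0

theorem binaryPartitionSeries_mul_one_sub_X :
    binaryPartitionSeries * (1 - X) = expand 2 two_ne_zero binaryPartitionSeries := by
  rw [mul_sub, mul_one]
  apply ext_parity
  · rw [coeff_expand_two_zero]; simp
  · intro n
    rw [coeff_expand_two_odd, map_sub, coeff_succ_mul_X, binaryPartitionSeries, coeff_mk, coeff_mk,
      binaryPartition_odd, sub_self]
  · intro n
    rw [coeff_expand_two_even, map_sub, coeff_succ_mul_X, binaryPartitionSeries, coeff_mk,
      coeff_mk, coeff_mk, binaryPartition_even]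
    push_cast; ring

theorem thueMorseSeries_eq :
    thueMorseSeries = (1 - X) * expand 2 two_ne_zero thueMorseSeries := by
  rw [sub_mul, one_mul]
  apply ext_parity
  · rw [map_sub, coeff_expand_two_zero]; simp
  · intro n
    rw [map_sub, coeff_expand_two_odd, coeff_succ_X_mul, coeff_thueMorseSeries,
      thueMorseSign_two_mul_add_one]
    cases n with
    | zero => rw [mul_zero, coeff_expand_two_zero, coeff_thueMorseSeries]; ring
    | succ n => rw [mul_add, mul_one, coeff_expand_two_even, coeff_thueMorseSeries]; ring
  · intro n
    rw [map_sub, coeff_expand_two_even, coeff_succ_X_mul, coeff_expand_two_odd,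
      coeff_thueMorseSeries, coeff_thueMorseSeries, show 2 * n + 2 = 2 * (n + 1) by ring,
      thueMorseSign_two_mul, sub_zero]

theorem eq_one_of_expand_eq_self {f : ℤ⟦X⟧} (hf : expand 2 two_ne_zero f = f)
    (h0 : coeff 0 f = 1) : f = 1 := by
  ext n
  induction n using Nat.strong_induction_on with
  | _ n ih =>
    rcases Nat.even_or_odd' n with ⟨c, rfl | rfl⟩
    · cases c with
      | zero => simpa using h0
      | succ c =>
        rw [← hf, mul_add, mul_one, coeff_expand_two_even, ih _ (by omega)]
        simp [coeff_one]
    · rw [← hf, coeff_expand_two_odd]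
      simp [coeff_one]

/-- The factors `1 - X` in the two functional equations cancel, so the product is invariant under `X
↦ X²` and therefore constant. -/
theorem binaryPartitionSeries_mul_thueMorseSeries :
    binaryPartitionSeries * thueMorseSeries = 1 := by
  apply eq_one_of_expand_eq_self
  · rw [map_mul, ← binaryPartitionSeries_mul_one_sub_X, mul_assoc, ← thueMorseSeries_eq]
  · simp [binaryPartitionSeries, thueMorseSeries, binaryPartition_zero, thueMorseSign_zero]

theorem coloredBinaryPartition_eq_coeff (m n : ℕ) :
    (coloredBinaryPartition m n : ℤ) = coeff n (binaryPartitionSeries ^ m) := by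
  have h : binaryPartitionSeries ^ m = ∏ _j : Fin m, binaryPartitionSeries := by simp
  rw [h, coeff_prod, coloredBinaryPartition]
  push_cast
  symm
  refine Finset.sum_nbij' (fun l => ⇑l) (fun l => Finsupp.equivFunOnFinite.symm l) ?_ ?_ ?_ ?_ ?_
  · intro l hl
    simp only [Finset.mem_finsuppAntidiag, Finset.mem_piAntidiag] at hl ⊢
    exact ⟨hl.1, by simp⟩
  · intro l hl
    simp only [Finset.mem_finsuppAntidiag, Finset.mem_piAntidiag] at hl ⊢
    exact ⟨by simpa using hl.1, by simp⟩
  · intro l _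
    ext; simp
  · intro l _
    ext; simp
  · intro l _
    simp [binaryPartitionSeries]

/-! ### Congruences for powers of the generating function -/

theorem exists_eq_mul_of_dvd_coeff {M : ℤ} {f : ℤ⟦X⟧} (h : ∀ n, M ∣ coeff n f) :
    ∃ g : ℤ⟦X⟧, f = C M * g := by
  choose g hg using h
  exact ⟨PowerSeries.mk g, by ext n; rw [coeff_C_mul, coeff_mk, hg]⟩

/-- Uniqueness modulo `M` for the functional equation of `B²`: each coefficient is determined by
earlier ones and the constant term. -/
theorem dvd_coeff_of_functional_equation {M : ℤ} {W : ℤ⟦X⟧} (h0 : coeff 0 W = 0)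
    (h : ∀ n, M ∣ coeff n (W * (1 - X) ^ 2 - expand 2 two_ne_zero W)) (n : ℕ) :
    M ∣ coeff n W := by
  have hW : W * (1 - X) ^ 2 - expand 2 two_ne_zero W =
      W - 2 * (W * X) + W * X * X - expand 2 two_ne_zero W := by ring
  rw [hW] at h
  have h2 : ∀ (m : ℕ) (f : ℤ⟦X⟧), coeff m (2 * f) = 2 * coeff m f := fun m f => by
    rw [two_mul, map_add, two_mul]
  induction n using Nat.strong_induction_on with
  | _ n ih =>
    have hn := h n
    have hE : n ≠ 0 → M ∣ coeff n (expand 2 two_ne_zero W) := by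
      intro hn0
      rw [coeff_expand]
      split_ifs with hd
      · exact ih _ (by omega)
      · exact dvd_zero _
    match n with
    | 0 => rw [h0]; exact dvd_zero _
    | 1 =>
      rw [map_sub, map_add, map_sub, h2] at hn
      have hX : coeff 1 (W * X * X) = 0 := by
        rw [show (1 : ℕ) = 0 + 1 from rfl, coeff_succ_mul_X, coeff_zero_mul_X]
      rw [hX, coeff_succ_mul_X] at hn
      have := (dvd_add (dvd_add hn (hE one_ne_zero)) ((ih 0 one_pos).mul_left 2))
      refine (congrArg (M ∣ ·) ?_).mpr this
      ring
    | n + 2 =>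
      rw [map_sub, map_add, map_sub, h2, coeff_succ_mul_X, coeff_succ_mul_X, coeff_succ_mul_X]
        at hn
      have := dvd_sub (dvd_add (dvd_add hn (hE (by omega))) ((ih (n + 1) (by omega)).mul_left 2))
        (ih n (by omega))
      refine (congrArg (M ∣ ·) ?_).mpr this
      ring

theorem exists_binaryPartitionSeries_sq :
    ∃ W : ℤ⟦X⟧, binaryPartitionSeries ^ 2 = (1 + X) ^ 2 + 4 * X ^ 2 + 8 * W := by
  have h8 : (C 8 : ℤ⟦X⟧) = 8 := by simp
  have h4 : expand 2 two_ne_zero (4 : ℤ⟦X⟧) = 4 := map_ofNat _ 4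
  -- The polynomial `1 + 2X + 5X²` satisfies the functional equation of `B²` up to `8 X³`.
  have h : (binaryPartitionSeries ^ 2 - ((1 + X) ^ 2 + 4 * X ^ 2)) * (1 - X) ^ 2 -
      expand 2 two_ne_zero (binaryPartitionSeries ^ 2 - ((1 + X) ^ 2 + 4 * X ^ 2)) =
      C 8 * X ^ 3 := by
    simp only [map_sub, map_pow, map_add, map_mul, map_one, expand_X, h8, h4,
      ← binaryPartitionSeries_mul_one_sub_X]
    ring
  have hdvd : ∀ n, 8 ∣ coeff n (binaryPartitionSeries ^ 2 - ((1 + X) ^ 2 + 4 * X ^ 2)) := by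
    apply dvd_coeff_of_functional_equation
    · simp [binaryPartitionSeries, binaryPartition_zero]
    · intro n
      rw [h, coeff_C_mul]
      exact dvd_mul_right _ _
  obtain ⟨W, hW⟩ := exists_eq_mul_of_dvd_coeff hdvd
  rw [h8] at hW
  exact ⟨W, by linear_combination hW⟩

theorem one_add_pow_sixteen {R : Type*} [CommRing R] (y : R) :
    (1 + y) ^ 16 = (1 + y ^ 2) ^ 8 + 16 * ((y + y ^ 2 + y ^ 3) * (1 + y ^ 2) ^ 6) +
      32 * (3 * (1 + y ^ 2) ^ 4 * (y + y ^ 2 + y ^ 3) ^ 2 +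
        8 * (1 + y ^ 2) ^ 2 * (y + y ^ 2 + y ^ 3) ^ 3 + 8 * (y + y ^ 2 + y ^ 3) ^ 4) := by
  have h : (1 + y) ^ 4 = (1 + y ^ 2) ^ 2 + 4 * (y + y ^ 2 + y ^ 3) := by ring
  have : (1 + y) ^ 16 = ((1 + y) ^ 4) ^ 4 := by ring
  rw [this, h]
  generalize y + y ^ 2 + y ^ 3 = Z
  ring

theorem exists_binaryPartitionSeries_pow_eight :
    ∃ R : ℤ⟦X⟧, binaryPartitionSeries ^ 8 =
      (1 + X) ^ 8 + 16 * (X ^ 2 * (1 + X) ^ 6) + 32 * R := by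
  obtain ⟨W, hW⟩ := exists_binaryPartitionSeries_sq
  have h : binaryPartitionSeries ^ 8 = (binaryPartitionSeries ^ 2) ^ 4 := by ring
  rw [h, hW]
  generalize hV : (1 + X : ℤ⟦X⟧) = Y
  refine ⟨(Y ^ 2 + 4 * X ^ 2) ^ 3 * W + 12 * (Y ^ 2 + 4 * X ^ 2) ^ 2 * W ^ 2 +
    64 * (Y ^ 2 + 4 * X ^ 2) * W ^ 3 + 128 * W ^ 4 +
    3 * X ^ 4 * Y ^ 4 + 8 * X ^ 6 * Y ^ 2 + 8 * X ^ 8, ?_⟩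
  ring

/-- Corrections divisible by 16 disappear modulo 32 on squaring, and `(1 + y)^16` agrees with `(1 +
y²)^8` modulo 16. -/
theorem exists_binaryPartitionSeries_pow (i : ℕ) :
    ∃ R : ℤ⟦X⟧, binaryPartitionSeries ^ 2 ^ (i + 4) = (1 + X ^ 2 ^ i) ^ 16 + 32 * R := by
  induction i with
  | zero =>
    obtain ⟨R, hR⟩ := exists_binaryPartitionSeries_pow_eight
    have h : binaryPartitionSeries ^ 2 ^ (0 + 4) = (binaryPartitionSeries ^ 8) ^ 2 := by ring
    rw [h, hR]
    generalize hV : (1 + X : ℤ⟦X⟧) = Y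
    simp only [pow_zero, pow_one, hV]
    refine ⟨X ^ 2 * Y ^ 14 + 8 * (X ^ 2 * Y ^ 6) ^ 2 +
      2 * R * (Y ^ 8 + 16 * (X ^ 2 * Y ^ 6)) + 32 * R ^ 2, ?_⟩
    ring
  | succ i ih =>
    obtain ⟨R, hR⟩ := ih
    have h : binaryPartitionSeries ^ 2 ^ (i + 1 + 4) =
        (binaryPartitionSeries ^ 2 ^ (i + 4)) ^ 2 := by rw [← pow_mul]; ring_nf
    have h2 : (X ^ 2 ^ (i + 1) : ℤ⟦X⟧) = (X ^ 2 ^ i) ^ 2 := by rw [← pow_mul]; ring_nf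
    rw [h, hR, h2, one_add_pow_sixteen]
    generalize (X ^ 2 ^ i : ℤ⟦X⟧) = y
    generalize (3 * (1 + y ^ 2) ^ 4 * (y + y ^ 2 + y ^ 3) ^ 2 +
        8 * (1 + y ^ 2) ^ 2 * (y + y ^ 2 + y ^ 3) ^ 3 + 8 * (y + y ^ 2 + y ^ 3) ^ 4) = S
    generalize (y + y ^ 2 + y ^ 3) * (1 + y ^ 2) ^ 6 = Q
    generalize (1 + y ^ 2) = P
    refine ⟨P ^ 8 * Q + 8 * Q ^ 2 + 2 * (S + R) * (P ^ 8 + 16 * Q) + 32 * (S + R) ^ 2, ?_⟩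
    ring

theorem exists_binaryPartitionSeries_pow_two_pow (i : ℕ) :
    ∃ (Q : Polynomial ℤ) (R : ℤ⟦X⟧), Q.natDegree ≤ 2 ^ (i + 3) ∧ 2 ∣ Q.eval 1 ∧
      binaryPartitionSeries ^ 2 ^ (i + 3) = (1 + X ^ 2 ^ i) ^ 8 + 16 * (Q : ℤ⟦X⟧) + 32 * R := by
  cases i with
  | zero =>
    obtain ⟨R, hR⟩ := exists_binaryPartitionSeries_pow_eight
    refine ⟨Polynomial.X ^ 2 * (1 + Polynomial.X) ^ 6, R, ?_, ?_, ?_⟩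
    · rw [show 2 ^ (0 + 3) = 8 by norm_num]; compute_degree
    · norm_num
    · rw [pow_zero, pow_one, show 2 ^ (0 + 3) = 8 by norm_num, hR]
      push_cast; rfl
  | succ i =>
    obtain ⟨R, hR⟩ := exists_binaryPartitionSeries_pow i
    obtain ⟨S, hS⟩ : ∃ S : ℤ⟦X⟧, binaryPartitionSeries ^ 2 ^ (i + 4) =
        (1 + (X ^ 2 ^ i) ^ 2) ^ 8 + 16 * ((X ^ 2 ^ i + (X ^ 2 ^ i) ^ 2 + (X ^ 2 ^ i) ^ 3) *
          (1 + (X ^ 2 ^ i) ^ 2) ^ 6) + 32 * S :=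
      ⟨_, by rw [hR, one_add_pow_sixteen, add_assoc, ← mul_add]⟩
    refine ⟨(Polynomial.X ^ 2 ^ i + (Polynomial.X ^ 2 ^ i) ^ 2 + (Polynomial.X ^ 2 ^ i) ^ 3) *
      (1 + (Polynomial.X ^ 2 ^ i) ^ 2) ^ 6, S, ?_, ?_, ?_⟩
    · have h1 : (Polynomial.X ^ 2 ^ i + (Polynomial.X ^ 2 ^ i) ^ 2 + (Polynomial.X ^ 2 ^ i) ^ 3 :
        Polynomial ℤ).natDegree ≤ 2 ^ i * 3 := by
        simp only [← pow_mul]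
        compute_degree
        omega
      have h2 : ((1 + (Polynomial.X ^ 2 ^ i) ^ 2) ^ 6 : Polynomial ℤ).natDegree ≤
          6 * (2 ^ i * 2) := by
        refine Polynomial.natDegree_pow_le_of_le 6 ?_
        simp only [← pow_mul]
        compute_degree
      refine (Polynomial.natDegree_mul_le_of_le h1 h2).trans ?_
      rw [show i + 1 + 3 = i + 4 by ring, pow_add]
      omega
    · simp
    · rw [show i + 1 + 3 = i + 4 by ring, hS,
        show (X ^ 2 ^ (i + 1) : ℤ⟦X⟧) = (X ^ 2 ^ i) ^ 2 by rw [← pow_mul]; ring_nf]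
      push_cast
      rfl

/-- Modulo 2 every coefficient of `T` is 1, so from the degree of `Q` on each coefficient of the
product is `Q(1)`. -/
theorem dvd_coeff_polynomial_mul_thueMorseSeries (Q : Polynomial ℤ) (n : ℕ)
    (hdeg : Q.natDegree ≤ n) (h : 2 ∣ Q.eval 1) :
    2 ∣ coeff n ((Q : ℤ⟦X⟧) * thueMorseSeries) := by
  rw [coeff_mul, Finset.Nat.sum_antidiagonal_eq_sum_range_succ_mk]
  rw [Polynomial.eval_eq_sum_range' (Nat.lt_succ_of_le hdeg)] at h
  refine (dvd_iff_dvd_of_dvd_sub ?_).mp h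
  rw [← Finset.sum_sub_distrib]
  refine Finset.dvd_sum fun i _ => ?_
  rw [Polynomial.coeff_coe, coeff_thueMorseSeries, one_pow]
  rcases thueMorseSign_eq (n - i) with e | e
  · rw [e]; simp
  · rw [e]; exact ⟨Q.coeff i, by ring⟩

/-- The residue of `b_{2^k-1}(n)` modulo `32` in terms of the Thue–Morse sequence. -/
theorem coloredBinaryPartition_modEq (i n : ℕ) (hn : 2 ^ (i + 3) ≤ n) :
    (coloredBinaryPartition (2 ^ (i + 3) - 1) n : ℤ) ≡
      thueMorseSign n + 8 * thueMorseSign (n - 2 ^ i) + 28 * thueMorseSign (n - 2 ^ i * 2) +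
      56 * thueMorseSign (n - 2 ^ i * 3) + 70 * thueMorseSign (n - 2 ^ i * 4) +
      56 * thueMorseSign (n - 2 ^ i * 5) + 28 * thueMorseSign (n - 2 ^ i * 6) +
      8 * thueMorseSign (n - 2 ^ i * 7) + thueMorseSign (n - 2 ^ i * 8) [ZMOD 32] := by
  obtain ⟨Q, R, hdeg, heval, hB⟩ := exists_binaryPartitionSeries_pow_two_pow i
  have h1 : binaryPartitionSeries ^ (2 ^ (i + 3) - 1) =
      binaryPartitionSeries ^ 2 ^ (i + 3) * thueMorseSeries := by
    have : binaryPartitionSeries ^ 2 ^ (i + 3) =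
        binaryPartitionSeries ^ (2 ^ (i + 3) - 1) * binaryPartitionSeries := by
      rw [← pow_succ, Nat.sub_add_cancel Nat.one_le_two_pow]
    rw [this, mul_assoc, binaryPartitionSeries_mul_thueMorseSeries, mul_one]
  rw [coloredBinaryPartition_eq_coeff, h1, hB]
  have h2 : ((1 + X ^ 2 ^ i) ^ 8 + 16 * (Q : ℤ⟦X⟧) + 32 * R) * thueMorseSeries =
      thueMorseSeries + C 8 * (X ^ 2 ^ i * thueMorseSeries) +
      C 28 * (X ^ (2 ^ i * 2) * thueMorseSeries) + C 56 * (X ^ (2 ^ i * 3) * thueMorseSeries) +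
      C 70 * (X ^ (2 ^ i * 4) * thueMorseSeries) + C 56 * (X ^ (2 ^ i * 5) * thueMorseSeries) +
      C 28 * (X ^ (2 ^ i * 6) * thueMorseSeries) + C 8 * (X ^ (2 ^ i * 7) * thueMorseSeries) +
      X ^ (2 ^ i * 8) * thueMorseSeries + C 16 * ((Q : ℤ⟦X⟧) * thueMorseSeries) +
      C 32 * (R * thueMorseSeries) := by
    simp only [pow_mul]
    generalize (X ^ 2 ^ i : ℤ⟦X⟧) = y
    simp only [map_ofNat]
    ring
  obtain ⟨c, hc⟩ := dvd_coeff_polynomial_mul_thueMorseSeries Q n (hdeg.trans hn) heval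
  have hX : ∀ j, j ≤ n → coeff n (X ^ j * thueMorseSeries) = thueMorseSign (n - j) := by
    intro j hj
    rw [coeff_X_pow_mul', if_pos hj, coeff_thueMorseSeries]
  rw [pow_add] at hn
  rw [h2]
  simp only [map_add, coeff_C_mul, hc, coeff_thueMorseSeries]
  rw [hX _ (by omega), hX _ (by omega), hX _ (by omega), hX _ (by omega), hX _ (by omega),
    hX _ (by omega), hX _ (by omega), hX _ (by omega)]
  refine (Int.modEq_iff_dvd.mpr ⟨-(c + coeff n (R * thueMorseSeries)), ?_⟩)
  ring

theorem thueMorseSign_small : thueMorseSign 1 = -1 ∧ thueMorseSign 2 = -1 ∧ thueMorseSign 3 = 1 ∧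
    thueMorseSign 4 = -1 ∧ thueMorseSign 5 = 1 ∧ thueMorseSign 6 = 1 ∧ thueMorseSign 7 = -1 := by
  simp [thueMorseSign]

/-- Modulo 4 only the binomials 1, 70, 1 survive, which leaves `t(s) (t(a+1) + t(a)) + 2` and
explains the dichotomy; the refinement modulo 32 is a finite check over `s` and the two signs. -/
theorem thueMorseSign_window (a s : ℕ) (hs : s < 8) (S : ℤ)
    (hS : S = thueMorseSign (8 * a + (8 + s)) + 8 * thueMorseSign (8 * a + (7 + s)) +
      28 * thueMorseSign (8 * a + (6 + s)) + 56 * thueMorseSign (8 * a + (5 + s)) +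
      70 * thueMorseSign (8 * a + (4 + s)) + 56 * thueMorseSign (8 * a + (3 + s)) +
      28 * thueMorseSign (8 * a + (2 + s)) + 8 * thueMorseSign (8 * a + (1 + s)) +
      thueMorseSign (8 * a + s)) :
    (thueMorseSign (a + 1) = thueMorseSign a ∧
      S % 32 = (-4 * thueMorseSign (8 * a + (8 + s))) % 32) ∨
    (thueMorseSign (a + 1) ≠ thueMorseSign a ∧ S % 4 = 2) := by
  have low : ∀ c < 8, thueMorseSign (8 * a + c) = thueMorseSign a * thueMorseSign c :=
    fun c hc => thueMorseSign_pow_mul_add 3 _ c hc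
  have high : ∀ c < 8, thueMorseSign (8 * a + (8 + c)) = thueMorseSign (a + 1) * thueMorseSign c :=
    fun c hc => by
      rw [← thueMorseSign_pow_mul_add 3 _ c hc]
      congr 1
      ring
  obtain ⟨t1, t2, t3, t4, t5, t6, t7⟩ := thueMorseSign_small
  have g0 := high 0 (by norm_num)
  have g1 := high 1 (by norm_num)
  have g2 := high 2 (by norm_num)
  have g3 := high 3 (by norm_num)
  have g4 := high 4 (by norm_num)
  have g5 := high 5 (by norm_num)
  have g6 := high 6 (by norm_num)
  have g7 := high 7 (by norm_num)
  have l0 := low 0 (by norm_num)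
  have l1 := low 1 (by norm_num)
  have l2 := low 2 (by norm_num)
  have l3 := low 3 (by norm_num)
  have l4 := low 4 (by norm_num)
  have l5 := low 5 (by norm_num)
  have l6 := low 6 (by norm_num)
  have l7 := low 7 (by norm_num)
  rw [thueMorseSign_zero] at g0 l0
  rw [t1] at g1 l1
  rw [t2] at g2 l2
  rw [t3] at g3 l3
  rw [t4] at g4 l4
  rw [t5] at g5 l5
  rw [t6] at g6 l6
  rw [t7] at g7 l7
  simp only [Nat.reduceAdd] at g0 g1 g2 g3 g4 g5 g6 g7
  clear low high
  interval_cases s <;>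
    simp only [Nat.reduceAdd, g0, g1, g2, g3, g4, g5, g6, g7, l0, l1, l2, l3, l4, l5, l6, l7] at hS ⊢ <;>
    clear g0 g1 g2 g3 g4 g5 g6 g7 l0 l1 l2 l3 l4 l5 l6 l7 t1 t2 t3 t4 t5 t6 t7 <;>
    rcases thueMorseSign_eq (a + 1) with h1 | h1 <;>
    rcases thueMorseSign_eq a with h2 | h2 <;>
    rw [h1, h2] at hS ⊢ <;> subst hS <;> decide

theorem coloredBinaryPartition_emod (i a r : ℕ) (hr : r < 2 ^ (i + 3)) :
    (thueMorseSign (a + 1) = thueMorseSign a ∧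
      (coloredBinaryPartition (2 ^ (i + 3) - 1) (2 ^ (i + 3) * (a + 1) + r) : ℤ) % 32 =
        (-4 * thueMorseSign (2 ^ (i + 3) * (a + 1) + r)) % 32) ∨
    (thueMorseSign (a + 1) ≠ thueMorseSign a ∧
      (coloredBinaryPartition (2 ^ (i + 3) - 1) (2 ^ (i + 3) * (a + 1) + r) : ℤ) % 4 = 2) := by
  have hmod := coloredBinaryPartition_modEq i (2 ^ (i + 3) * (a + 1) + r)
    (by nlinarith [Nat.zero_le (2 ^ (i + 3) * a)])
  generalize (coloredBinaryPartition (2 ^ (i + 3) - 1) (2 ^ (i + 3) * (a + 1) + r) : ℤ) = b at *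
  -- All nine arguments share the low part `u`, so `t(u)` factors out and the window is one of
  -- blocks of length `2^i`.
  obtain ⟨s, u, hu, rfl⟩ : ∃ s u, u < 2 ^ i ∧ r = 2 ^ i * s + u :=
    ⟨r / 2 ^ i, r % 2 ^ i, Nat.mod_lt _ (by positivity), (Nat.div_add_mod _ _).symm⟩
  have hs : s < 8 := by
    by_contra hs
    have : 2 ^ i * 8 ≤ 2 ^ i * s := Nat.mul_le_mul_left _ (not_lt.mp hs)
    rw [pow_add] at hr
    omega
  have key : ∀ j l, l + j = 8 → 2 ^ (i + 3) * (a + 1) + (2 ^ i * s + u) - 2 ^ i * j =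
      2 ^ i * (8 * a + (l + s)) + u := by
    intro j l hj
    have e : 2 ^ (i + 3) * (a + 1) + (2 ^ i * s + u) =
        2 ^ i * (8 * a + (l + s)) + u + 2 ^ i * j := by
      rw [show 2 ^ (i + 3) = 2 ^ i * (l + j) by rw [hj, pow_add]; norm_num]
      linear_combination (2 ^ i * a) * hj
    omega
  have k0 := key 0 8 (by norm_num)
  rw [mul_zero, Nat.sub_zero] at k0
  have k1 := key 1 7 (by norm_num)
  rw [mul_one] at k1
  rw [key 2 6 (by norm_num), key 3 5 (by norm_num), key 4 4 (by norm_num), key 5 3 (by norm_num),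
    key 6 2 (by norm_num), key 7 1 (by norm_num), key 8 0 (by norm_num), k1, k0, zero_add] at hmod
  rw [k0]
  simp only [thueMorseSign_pow_mul_add i _ u hu] at hmod ⊢
  have hw := thueMorseSign_window a s hs _ rfl
  unfold Int.ModEq at hmod
  rcases thueMorseSign_eq u with hu' | hu' <;> rw [hu'] at hmod ⊢ <;> omega

end Series

/-! ### The exceptional set -/

theorem mem_notSumThreeSquares_iff (i a r : ℕ) (hr : r < 2 ^ (i + 3)) :
    2 ^ (i + 3) * (a + 1) + r ∈ notSumThreeSquares (2 ^ (i + 3) - 1) ↔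
      thueMorseSign (a + 1) = thueMorseSign a ∧
        thueMorseSign (2 ^ (i + 3) * (a + 1) + r) = 1 := by
  have h := coloredBinaryPartition_emod i a r hr
  unfold notSumThreeSquares
  rw [Set.mem_ofPred_eq]
  generalize 2 ^ (i + 3) * (a + 1) + r = n at *
  rcases h with ⟨h1, h2⟩ | ⟨h1, h2⟩
  · simp only [h1, true_and]
    rcases thueMorseSign_eq n with h | h
    · simp only [h, iff_true]
      exact not_sum_three_sq_of_emod_eq _ (by rw [h2, h]; norm_num)
    · simp only [h, Int.reduceNeg, reduceCtorEq, iff_false, not_not]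
      rw [h] at h2
      obtain ⟨u, v, w, huvw⟩ := sum_three_sq_of_mod_eight_eq_one
        (coloredBinaryPartition (2 ^ (i + 3) - 1) n / 4) (by omega)
      have hdiv : (coloredBinaryPartition (2 ^ (i + 3) - 1) n : ℤ) =
          4 * (coloredBinaryPartition (2 ^ (i + 3) - 1) n / 4 : ℕ) := by omega
      exact ⟨2 * u, 2 * v, 2 * w, by rw [hdiv, huvw]; ring⟩
  · simp only [h1, false_and, iff_false, not_not]
    exact sum_three_sq_of_mod_four_eq_two _ (by omega)

/-! ### Counting -/

theorem count_thueMorseSign_eq (e : ℤ) (he : e = 1 ∨ e = -1) (K : ℕ) :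
    Nat.count (fun r => thueMorseSign r = e) (2 * K) = K := by
  induction K with
  | zero => simp
  | succ K ih =>
    rw [show 2 * (K + 1) = 2 * K + 1 + 1 by ring, Nat.count_succ, Nat.count_succ, ih,
      thueMorseSign_two_mul, thueMorseSign_two_mul_add_one]
    rcases thueMorseSign_eq K with h | h <;> rcases he with rfl | rfl <;> simp [h]

theorem count_congr_of_lt {p q : ℕ → Prop} [DecidablePred p] [DecidablePred q] {n : ℕ}
    (h : ∀ m < n, (p m ↔ q m)) : Nat.count p n = Nat.count q n := by
  rw [Nat.count_eq_card_filter_range, Nat.count_eq_card_filter_range]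
  congr 1
  exact Finset.filter_congr fun m hm => h m (Finset.mem_range.mp hm)

/-- The number of `1 ≤ a ≤ A` such that the Thue–Morse sequence agrees at `a - 1` and `a`. -/
def thueMorseRepeatCount (A : ℕ) : ℕ :=
  Nat.count (fun a => thueMorseSign (a + 1) = thueMorseSign a) A

theorem thueMorseRepeatCount_succ (A : ℕ) : thueMorseRepeatCount (A + 1) =
    thueMorseRepeatCount A + if thueMorseSign (A + 1) = thueMorseSign A then 1 else 0 :=
  Nat.count_succ _ _

theorem thueMorseRepeatCount_odd (A : ℕ) :
    thueMorseRepeatCount (2 * A + 1) = thueMorseRepeatCount (2 * A) := by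
  rw [thueMorseRepeatCount_succ, thueMorseSign_two_mul_add_one, thueMorseSign_two_mul]
  rcases thueMorseSign_eq A with h | h <;> simp [h]

/-- The signs at `2A` and `2A+1` always differ; those at `2A+1` and `2A+2` agree exactly when those
at `A` and `A+1` differ. -/
theorem thueMorseRepeatCount_even (A : ℕ) :
    thueMorseRepeatCount (2 * A) + thueMorseRepeatCount A = A := by
  induction A with
  | zero => simp [thueMorseRepeatCount]
  | succ A ih =>
    rw [show 2 * (A + 1) = 2 * A + 1 + 1 by ring, thueMorseRepeatCount_succ (2 * A + 1),
      thueMorseRepeatCount_odd, thueMorseRepeatCount_succ A,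
      show 2 * A + 1 + 1 = 2 * (A + 1) by ring, thueMorseSign_two_mul,
      thueMorseSign_two_mul_add_one]
    rcases thueMorseSign_eq A with h | h <;> rcases thueMorseSign_eq (A + 1) with h' | h' <;>
      simp [h, h'] <;> omega

/-- Three times the deviation of `thueMorseRepeatCount A` from `A / 3`. -/
def thueMorseDiscrepancy (A : ℕ) : ℤ := 3 * thueMorseRepeatCount A - A

theorem thueMorseDiscrepancy_zero : thueMorseDiscrepancy 0 = 0 := by
  simp [thueMorseDiscrepancy, thueMorseRepeatCount]

theorem thueMorseDiscrepancy_two_mul (A : ℕ) :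
    thueMorseDiscrepancy (2 * A) = -thueMorseDiscrepancy A := by
  have := thueMorseRepeatCount_even A
  unfold thueMorseDiscrepancy
  omega

theorem thueMorseDiscrepancy_two_mul_add_one (A : ℕ) :
    thueMorseDiscrepancy (2 * A + 1) = -thueMorseDiscrepancy A - 1 := by
  have := thueMorseRepeatCount_even A
  have := thueMorseRepeatCount_odd A
  unfold thueMorseDiscrepancy
  omega

theorem thueMorseDiscrepancy_four_mul_add (A : ℕ) :
    thueMorseDiscrepancy (4 * A) = thueMorseDiscrepancy A ∧
    thueMorseDiscrepancy (4 * A + 1) = thueMorseDiscrepancy A - 1 ∧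
    thueMorseDiscrepancy (4 * A + 2) = thueMorseDiscrepancy A + 1 ∧
    thueMorseDiscrepancy (4 * A + 3) = thueMorseDiscrepancy A := by
  rw [show 4 * A = 2 * (2 * A) by ring, show 2 * (2 * A) + 2 = 2 * (2 * A + 1) by ring,
    show 2 * (2 * A) + 3 = 2 * (2 * A + 1) + 1 by ring]
  simp only [thueMorseDiscrepancy_two_mul, thueMorseDiscrepancy_two_mul_add_one]
  omega

theorem abs_thueMorseDiscrepancy_succ_sub (A : ℕ) :
    |thueMorseDiscrepancy (A + 1) - thueMorseDiscrepancy A| ≤ 2 := by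
  unfold thueMorseDiscrepancy
  rw [thueMorseRepeatCount_succ, abs_le]
  split_ifs <;> push_cast <;> omega

/-- Each base-4 digit contributes at most 1 in absolute value. -/
theorem abs_thueMorseDiscrepancy_le (A : ℕ) : |thueMorseDiscrepancy A| ≤ Nat.log 4 A + 1 := by
  induction A using Nat.strong_induction_on with
  | _ A ih =>
    obtain ⟨h0, h1, h2, h3⟩ := thueMorseDiscrepancy_four_mul_add (A / 4)
    have hstep : |thueMorseDiscrepancy A| ≤ |thueMorseDiscrepancy (A / 4)| + 1 := by
      have hA : A = 4 * (A / 4) ∨ A = 4 * (A / 4) + 1 ∨ A = 4 * (A / 4) + 2 ∨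
        A = 4 * (A / 4) + 3 := by omega
      rcases hA with h | h | h | h
      · rw [← h] at h0; grind
      · rw [← h] at h1; grind
      · rw [← h] at h2; grind
      · rw [← h] at h3; grind
    rcases lt_or_ge A 4 with hA | hA
    · rw [Nat.div_eq_of_lt hA, thueMorseDiscrepancy_zero, abs_zero] at hstep
      omega
    · have hlog : Nat.log 4 A = Nat.log 4 (A / 4) + 1 := Nat.log_of_one_lt_of_le (by norm_num) hA
      have := ih (A / 4) (by omega)
      rw [hlog]
      push_cast
      omega

-- The initial block is kept as an unknown because the congruence needs `n ≥ 2^(i+3)`. In a later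
-- block the sign condition on `n` selects exactly half of the residues.
open Classical in
theorem count_notSumThreeSquares_block (i A : ℕ) :
    Nat.count (· ∈ notSumThreeSquares (2 ^ (i + 3) - 1)) (2 ^ (i + 3) * (A + 1)) =
      Nat.count (· ∈ notSumThreeSquares (2 ^ (i + 3) - 1)) (2 ^ (i + 3)) +
        2 ^ (i + 2) * thueMorseRepeatCount A := by
  induction A with
  | zero => simp [thueMorseRepeatCount]
  | succ A ih =>
    rw [show 2 ^ (i + 3) * (A + 1 + 1) = 2 ^ (i + 3) * (A + 1) + 2 ^ (i + 3) by ring,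
      Nat.count_add, ih, thueMorseRepeatCount_succ, add_assoc, mul_add (2 ^ (i + 2))]
    congr 2
    split_ifs with h
    · have hcongr : ∀ r < 2 ^ (i + 3),
          (2 ^ (i + 3) * (A + 1) + r ∈ notSumThreeSquares (2 ^ (i + 3) - 1) ↔
            thueMorseSign r = thueMorseSign (A + 1)) := by
        intro r hr
        rw [mem_notSumThreeSquares_iff i A r hr, thueMorseSign_pow_mul_add _ _ _ hr]
        rcases thueMorseSign_eq (A + 1) with h' | h' <;>
          rcases thueMorseSign_eq r with h'' | h'' <;> simp [← h, h', h'']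
      rw [count_congr_of_lt hcongr, pow_succ' 2 (i + 2),
        count_thueMorseSign_eq _ (thueMorseSign_eq _), mul_one]
    · have hcongr : ∀ r < 2 ^ (i + 3),
          (2 ^ (i + 3) * (A + 1) + r ∈ notSumThreeSquares (2 ^ (i + 3) - 1) ↔ False) := by
        intro r hr
        rw [mem_notSumThreeSquares_iff i A r hr]
        simp [h]
      rw [count_congr_of_lt hcongr]
      simp

open Classical in
theorem countNotSumThreeSquares_eq_count (m : ℕ) (x : ℝ) (hx : 0 ≤ x) :
    countNotSumThreeSquares m x = Nat.count (· ∈ notSumThreeSquares m) (⌊x⌋₊ + 1) := by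
  rw [Nat.count_eq_card_filter_range, countNotSumThreeSquares, ← Set.ncard_coe_finset]
  congr 1
  ext n
  simp only [Set.mem_ofPred_eq, Finset.coe_filter, Finset.mem_range, Nat.lt_succ_iff,
    Nat.le_floor_iff hx]
  tauto

theorem countNotSumThreeSquares_bounds (i : ℕ) (x : ℝ) (hx : 0 ≤ x) (A : ℕ)
    (hA : A = ⌊x⌋₊ / 2 ^ (i + 3)) :
    2 ^ (i + 2) * thueMorseRepeatCount A ≤
      countNotSumThreeSquares (2 ^ (i + 3) - 1) x + 2 ^ (i + 2) ∧
    countNotSumThreeSquares (2 ^ (i + 3) - 1) x ≤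
      2 * 2 ^ (i + 2) + 2 ^ (i + 2) * thueMorseRepeatCount A := by
  classical
  rw [countNotSumThreeSquares_eq_count _ _ hx]
  have hlo : 2 ^ (i + 3) * A ≤ ⌊x⌋₊ := hA ▸ Nat.mul_div_le _ _
  have hhi : ⌊x⌋₊ + 1 ≤ 2 ^ (i + 3) * (A + 1) := hA ▸ Nat.lt_mul_div_succ _ (by positivity)
  constructor
  · cases A with
    | zero => simp [thueMorseRepeatCount]
    | succ A =>
      have h1 := Nat.count_monotone (· ∈ notSumThreeSquares (2 ^ (i + 3) - 1))
        (show 2 ^ (i + 3) * (A + 1) ≤ ⌊x⌋₊ + 1 by omega)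
      rw [count_notSumThreeSquares_block] at h1
      rw [thueMorseRepeatCount_succ, mul_add]
      have : 2 ^ (i + 2) * (if thueMorseSign (A + 1) = thueMorseSign A then 1 else 0) ≤
          2 ^ (i + 2) := by
        split_ifs <;> simp
      omega
  · have h1 := Nat.count_monotone (· ∈ notSumThreeSquares (2 ^ (i + 3) - 1)) hhi
    rw [count_notSumThreeSquares_block] at h1
    have h2 := Nat.count_le (p := (· ∈ notSumThreeSquares (2 ^ (i + 3) - 1))) (n := 2 ^ (i + 3))
    have : 2 ^ (i + 3) = 2 * 2 ^ (i + 2) := by ring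
    omega

theorem abs_countNotSumThreeSquares_sub_le (i : ℕ) (x : ℝ) (hx : 0 ≤ x) :
    |(countNotSumThreeSquares (2 ^ (i + 3) - 1) x : ℝ) - x / 6 -
      2 ^ (i + 2) / 3 * thueMorseDiscrepancy (⌊x⌋₊ / 2 ^ (i + 3))| ≤ 2 * 2 ^ (i + 2) := by
  obtain ⟨A, hA⟩ : ∃ A, A = ⌊x⌋₊ / 2 ^ (i + 3) := ⟨_, rfl⟩
  obtain ⟨h1, h2⟩ := countNotSumThreeSquares_bounds i x hx A hA
  have hlo : 2 ^ (i + 3) * A ≤ ⌊x⌋₊ := hA ▸ Nat.mul_div_le _ _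
  have hhi : ⌊x⌋₊ < 2 ^ (i + 3) * (A + 1) := hA ▸ Nat.lt_mul_div_succ _ (by positivity)
  rw [Nat.le_floor_iff hx] at hlo
  rw [Nat.floor_lt hx] at hhi
  rw [← hA, thueMorseDiscrepancy]
  generalize countNotSumThreeSquares (2 ^ (i + 3) - 1) x = c at *
  have hp : (2 : ℝ) ^ (i + 3) = 2 * 2 ^ (i + 2) := by ring
  have hH : (0 : ℝ) < 2 ^ (i + 2) := by positivity
  have h1' : (2 : ℝ) ^ (i + 2) * thueMorseRepeatCount A ≤ c + 2 ^ (i + 2) := by exact_mod_cast h1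
  have h2' : (c : ℝ) ≤ 2 * 2 ^ (i + 2) + 2 ^ (i + 2) * thueMorseRepeatCount A := by
    exact_mod_cast h2
  push_cast at hlo hhi ⊢
  rw [hp] at hlo hhi
  generalize (2 : ℝ) ^ (i + 2) = H at *
  rw [abs_le]
  constructor <;> nlinarith

theorem abs_thueMorseDiscrepancy_le_logb (A : ℕ) :
    |(thueMorseDiscrepancy A : ℝ)| ≤ Real.logb 2 A / 2 + 1 := by
  have h1 : (|thueMorseDiscrepancy A| : ℝ) ≤ Nat.log 4 A + 1 := by
    exact_mod_cast abs_thueMorseDiscrepancy_le A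
  have h2 : (Nat.log 4 A : ℝ) ≤ Real.logb 4 A := by
    exact_mod_cast Real.natLog_le_logb A 4
  have h3 : Real.logb 4 A = Real.logb 2 A / 2 := by
    rw [Real.logb, Real.logb, show (4 : ℝ) = 2 ^ 2 by norm_num, Real.log_pow]
    push_cast
    field_simp
  linarith

theorem abs_countNotSumThreeSquares_sub_div_six_le (i : ℕ) (x : ℝ) (hx : (2 : ℝ) ^ (i + 3) ≤ x) :
    |(countNotSumThreeSquares (2 ^ (i + 3) - 1) x : ℝ) - x / 6| ≤
      (2 : ℝ) ^ (i + 1) / 3 * (Real.logb 2 x - (i + 3 : ℕ) + 26) := by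
  have hp : (0 : ℝ) < 2 ^ (i + 3) := by positivity
  have hx0 : 0 ≤ x := hp.le.trans hx
  have h1 := abs_countNotSumThreeSquares_sub_le i x hx0
  have hfloor : 2 ^ (i + 3) ≤ ⌊x⌋₊ := Nat.le_floor (by exact_mod_cast hx)
  have hA : 0 < ⌊x⌋₊ / 2 ^ (i + 3) := Nat.div_pos hfloor (by positivity)
  have h2 := abs_thueMorseDiscrepancy_le_logb (⌊x⌋₊ / 2 ^ (i + 3))
  have h3 : Real.logb 2 (⌊x⌋₊ / 2 ^ (i + 3) : ℕ) ≤ Real.logb 2 x - (i + 3 : ℕ) := by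
    have h4 : Real.logb 2 (x / 2 ^ (i + 3)) = Real.logb 2 x - (i + 3 : ℕ) := by
      rw [Real.logb_div (by linarith) hp.ne', Real.logb_pow, Real.logb_self_eq_one one_lt_two,
        mul_one]
    rw [← h4]
    refine Real.logb_le_logb_of_le one_lt_two (by exact_mod_cast hA) ?_
    refine Nat.cast_div_le.trans ?_
    push_cast
    gcongr
    exact Nat.floor_le hx0
  have hH : (2 : ℝ) ^ (i + 2) = 2 * 2 ^ (i + 1) := by ring
  have hJ : (0 : ℝ) < 2 ^ (i + 1) := by positivity
  rw [hH] at h1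
  generalize (2 : ℝ) ^ (i + 1) = J at *
  have h5 : |2 * J / 3 * (thueMorseDiscrepancy (⌊x⌋₊ / 2 ^ (i + 3)) : ℝ)| ≤
      2 * J / 3 * ((Real.logb 2 x - (i + 3 : ℕ)) / 2 + 1) := by
    rw [abs_mul, abs_of_pos (by positivity : 0 < 2 * J / 3)]
    gcongr
    linarith
  rw [abs_le] at h1 h5 ⊢
  -- The block error `4J` is `12 · J/3` and the digit bound adds `2 · J/3`, so 14 would suffice in
  -- place of 26.
  constructor <;> linarith [h1.1, h1.2, h5.1, h5.2]

/-! ### Asymptotics -/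

theorem tendsto_countNotSumThreeSquares_div (i : ℕ) :
    Tendsto (fun x : ℝ => (countNotSumThreeSquares (2 ^ (i + 3) - 1) x : ℝ) / x) atTop
      (𝓝 (1 / 6)) := by
  have hlog : Tendsto (fun x : ℝ => Real.log x / x) atTop (𝓝 0) :=
    Real.isLittleO_log_id_atTop.tendsto_div_nhds_zero
  have hinv : Tendsto (fun x : ℝ => x⁻¹) atTop (𝓝 0) := tendsto_inv_atTop_zero
  have hbound : Tendsto (fun x : ℝ => (2 : ℝ) ^ (i + 1) / 3 *
      ((Real.log 2)⁻¹ * (Real.log x / x) + (26 - (i + 3 : ℕ)) * x⁻¹)) atTop (𝓝 0) := by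
    simpa using ((hlog.const_mul _).add (hinv.const_mul _)).const_mul ((2 : ℝ) ^ (i + 1) / 3)
  rw [tendsto_iff_norm_sub_tendsto_zero]
  refine squeeze_zero' (Eventually.of_forall fun _ => norm_nonneg _) ?_ hbound
  filter_upwards [eventually_ge_atTop ((2 : ℝ) ^ (i + 3))] with x hx
  have hx0 : 0 < x := lt_of_lt_of_le (by positivity) hx
  have h := abs_countNotSumThreeSquares_sub_div_six_le i x hx
  have e : (countNotSumThreeSquares (2 ^ (i + 3) - 1) x : ℝ) / x - 1 / 6 =
      ((countNotSumThreeSquares (2 ^ (i + 3) - 1) x : ℝ) - x / 6) / x := by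
    field_simp
  rw [Real.norm_eq_abs, e, abs_div, abs_of_pos hx0, div_le_iff₀ hx0]
  refine h.trans (le_of_eq ?_)
  rw [Real.logb]
  field_simp
  ring

theorem isEquivalent_mul_natCast_of_abs_sub_le {f : ℕ → ℝ} {b c : ℝ} (hb : b ≠ 0)
    (h : ∀ᶠ l in atTop, |f l - b * l| ≤ c) : f ~[atTop] fun l : ℕ => b * l := by
  have h1 : (fun l : ℕ => f l - b * l) =O[atTop] fun _ => (1 : ℝ) :=
    IsBigO.of_bound c (by filter_upwards [h] with l hl; simpa using hl)
  have h2 : (fun _ : ℕ => (1 : ℝ)) =o[atTop] fun l : ℕ => b * l := by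
    refine (isLittleO_const_left.mpr (Or.inr ?_))
    have : Tendsto (fun l : ℕ => |b| * (l : ℝ)) atTop atTop :=
      tendsto_natCast_atTop_atTop.const_mul_atTop (abs_pos.mpr hb)
    refine this.congr fun l => ?_
    simp
  exact h1.trans_isLittleO h2

theorem isEquivalent_countNotSumThreeSquares (i : ℕ) (A : ℕ → ℕ) (b C : ℝ) (hb : b ≠ 0)
    (hlo : ∀ᶠ l in atTop, 16 ^ l ≤ 2 * A l) (hhi : ∀ l, A l ≤ 2 * 16 ^ l)
    (hdisc : ∀ l : ℕ, |(thueMorseDiscrepancy (A l) : ℝ) - 2 * b * l| ≤ C) :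
    (fun l => (countNotSumThreeSquares (2 ^ (i + 3) - 1) ((2 ^ (i + 3) * A l : ℕ) : ℝ) : ℝ) -
      ((2 ^ (i + 3) * A l : ℕ) : ℝ) / 6) ~[atTop]
    (fun l => b * ((2 : ℝ) ^ (i + 1) / 3 * Real.logb 2 ((2 ^ (i + 3) * A l : ℕ) : ℝ))) := by
  have hJ : (0 : ℝ) < 2 ^ (i + 1) := by positivity
  -- Both sides are within a bounded distance of this constant times `l`: the discrepancy is `2 b l
  -- + O(1)` and `log₂ (A l)` is `4 l + O(1)`.
  have hne : b * (4 * 2 ^ (i + 1) / 3) ≠ 0 := by positivity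
  refine IsEquivalent.trans (isEquivalent_mul_natCast_of_abs_sub_le hne
      (c := 4 * 2 ^ (i + 1) + 2 * 2 ^ (i + 1) / 3 * C) (Eventually.of_forall fun l => ?_))
    (isEquivalent_mul_natCast_of_abs_sub_le hne
      (c := |b| * (2 ^ (i + 1) / 3) * (i + 4)) ?_).symm
  · have h1 := abs_countNotSumThreeSquares_sub_le i ((2 ^ (i + 3) * A l : ℕ) : ℝ) (by positivity)
    rw [Nat.floor_natCast, Nat.mul_div_cancel_left _ (by positivity),
      show (2 : ℝ) ^ (i + 2) = 2 * 2 ^ (i + 1) by ring] at h1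
    have h2 : |2 * (2 : ℝ) ^ (i + 1) / 3 * (thueMorseDiscrepancy (A l) - 2 * b * l)| ≤
        2 * 2 ^ (i + 1) / 3 * C := by
      rw [abs_mul, abs_of_pos (by positivity : 0 < 2 * (2 : ℝ) ^ (i + 1) / 3)]
      exact mul_le_mul_of_nonneg_left (hdisc l) (by positivity)
    refine le_trans (le_of_eq ?_) ((abs_add_le _ _).trans (add_le_add h1 h2) |>.trans (le_of_eq ?_))
    · congr 1; ring
    · ring
  · filter_upwards [hlo] with l hl
    have hlo' : (16 : ℝ) ^ l / 2 ≤ A l := by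
      rw [div_le_iff₀ two_pos, mul_comm]
      exact_mod_cast hl
    have hhi' : (A l : ℝ) ≤ 2 * 16 ^ l := by exact_mod_cast hhi l
    have hApos : (0 : ℝ) < A l := lt_of_lt_of_le (by positivity) hlo'
    have hlog16 : Real.logb 2 ((16 : ℝ) ^ l) = 4 * l := by
      rw [show (16 : ℝ) = 2 ^ 4 by norm_num, ← pow_mul, Real.logb_pow,
        Real.logb_self_eq_one one_lt_two]
      push_cast; ring
    have h1 : 4 * (l : ℝ) - 1 ≤ Real.logb 2 (A l) := by
      rw [← hlog16, ← Real.logb_self_eq_one one_lt_two,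
        ← Real.logb_div (by positivity) two_ne_zero]
      exact Real.logb_le_logb_of_le one_lt_two (by positivity) hlo'
    have h2 : Real.logb 2 (A l) ≤ 1 + 4 * (l : ℝ) := by
      have hlog2 : Real.logb 2 2 = 1 := Real.logb_self_eq_one one_lt_two
      rw [← hlog16, ← hlog2, ← Real.logb_mul two_ne_zero (by positivity)]
      exact Real.logb_le_logb_of_le one_lt_two hApos hhi'
    have h3 : Real.logb 2 ((2 ^ (i + 3) * A l : ℕ) : ℝ) = i + 3 + Real.logb 2 (A l) := by
      push_cast
      rw [Real.logb_mul (by positivity) hApos.ne', Real.logb_pow,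
        Real.logb_self_eq_one one_lt_two]
      push_cast; ring
    rw [h3]
    have e : b * ((2 : ℝ) ^ (i + 1) / 3 * (i + 3 + Real.logb 2 (A l))) -
        b * (4 * 2 ^ (i + 1) / 3) * l =
        b * (2 ^ (i + 1) / 3) * (i + 3 + Real.logb 2 (A l) - 4 * l) := by ring
    rw [e, abs_mul, abs_mul, abs_of_pos (by positivity : 0 < (2 : ℝ) ^ (i + 1) / 3)]
    refine mul_le_mul_of_nonneg_left ?_ (by positivity)
    rw [abs_le]
    constructor <;> linarith [(Nat.cast_nonneg i : (0 : ℝ) ≤ i)]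

theorem thueMorseDiscrepancy_of_recurrence_ten {A : ℕ → ℕ} (h0 : A 0 = 0)
    (h : ∀ l, A (l + 1) = 16 * A l + 10) (l : ℕ) : thueMorseDiscrepancy (A l) = 2 * l := by
  induction l with
  | zero => simp [h0, thueMorseDiscrepancy_zero]
  | succ l ih =>
    -- Each step appends the base-4 digits 22, each of which adds 1.
    rw [h, show 16 * A l + 10 = 4 * (4 * A l + 2) + 2 by ring,
      (thueMorseDiscrepancy_four_mul_add _).2.2.1, (thueMorseDiscrepancy_four_mul_add _).2.2.1, ih]
    push_cast; ring

theorem thueMorseDiscrepancy_of_recurrence_twenty {A : ℕ → ℕ} (h0 : A 0 = 0)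
    (h : ∀ l, A (l + 1) = 16 * A l + 20) (l : ℕ) :
    thueMorseDiscrepancy (A l + 1) = -2 * l - 1 := by
  induction l with
  | zero =>
    have := thueMorseDiscrepancy_two_mul_add_one 0
    rw [mul_zero, zero_add, thueMorseDiscrepancy_zero] at this
    simp [h0, this]
  | succ l ih =>
    -- The shifted number `A l + 1` has only digits 1 in base 4; each step appends two more, each
    -- contributing -1.
    rw [h, show 16 * A l + 20 + 1 = 4 * (4 * (A l + 1) + 1) + 1 by ring,
      (thueMorseDiscrepancy_four_mul_add _).2.1, (thueMorseDiscrepancy_four_mul_add _).2.1, ih]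
    push_cast; ring

theorem exists_recurrence_sixteen (c : ℕ) :
    ∃ A : ℕ → ℕ, A 0 = 0 ∧ (∀ l, A (l + 1) = 16 * A l + c) ∧ ∀ l, 15 * A l + c = c * 16 ^ l := by
  obtain ⟨A, h0, h⟩ : ∃ A : ℕ → ℕ, A 0 = 0 ∧ ∀ l, A (l + 1) = 16 * A l + c :=
    ⟨fun l => Nat.rec 0 (fun _ a => 16 * a + c) l, rfl, fun _ => rfl⟩
  refine ⟨A, h0, h, fun l => ?_⟩
  induction l with
  | zero => simp [h0]
  | succ l ih => rw [h, pow_succ]; linear_combination 16 * ih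

theorem mainTheorem7 (k : ℕ) (hk : 3 ≤ k) :
    (∀ x : ℝ, (2 : ℝ) ^ k ≤ x →
      |(countNotSumThreeSquares (2 ^ k - 1) x : ℝ) - x / 6|
        ≤ (2 : ℝ) ^ (k - 2) / 3 * (Real.logb 2 x - (k : ℝ) + 26)) ∧
    Tendsto (fun x : ℝ => (countNotSumThreeSquares (2 ^ k - 1) x : ℝ) / x) atTop (𝓝 (1 / 6)) ∧
    ∃ m n : ℕ → ℕ,
      (m 0 = 0 ∧ ∀ l, m (l + 1) = 16 * m l + 5 * 2 ^ (k + 1)) ∧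
      (n 0 = 0 ∧ ∀ l, n (l + 1) = 16 * n l + 10 * 2 ^ (k + 1)) ∧
      StrictMono m ∧ StrictMono n ∧
      (fun l => (countNotSumThreeSquares (2 ^ k - 1) (m l : ℝ) : ℝ) - (m l : ℝ) / 6)
        ~[atTop] (fun l => (2 : ℝ) ^ (k - 2) / 3 * Real.logb 2 (m l : ℝ)) ∧
      (fun l => (countNotSumThreeSquares (2 ^ k - 1) (n l : ℝ) : ℝ) - (n l : ℝ) / 6)
        ~[atTop] (fun l => -((2 : ℝ) ^ (k - 2) / 3 * Real.logb 2 (n l : ℝ))) := by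
  obtain ⟨i, rfl⟩ : ∃ i, k = i + 3 := ⟨k - 3, by omega⟩
  rw [show i + 3 - 2 = i + 1 by omega]
  refine ⟨fun x hx => abs_countNotSumThreeSquares_sub_div_six_le i x hx,
    tendsto_countNotSumThreeSquares_div i, ?_⟩
  -- Dividing the two recurrences by `2^k` turns `5 · 2^(k+1)` and `10 · 2^(k+1)` into 10 and 20.
  obtain ⟨A, hA0, hA, hAc⟩ := exists_recurrence_sixteen 10
  obtain ⟨B, hB0, hB, hBc⟩ := exists_recurrence_sixteen 20
  have hpos : 0 < 2 ^ (i + 3) := by positivity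
  have hpow : ∀ᶠ l : ℕ in atTop, 16 ≤ 16 ^ l := by
    filter_upwards [eventually_ge_atTop 1] with l hl
    exact Nat.le_self_pow (by omega) 16
  refine ⟨fun l => 2 ^ (i + 3) * A l, fun l => 2 ^ (i + 3) * B l, ⟨by simp [hA0], fun l => ?_⟩,
    ⟨by simp [hB0], fun l => ?_⟩, strictMono_nat_of_lt_succ fun l => ?_,
    strictMono_nat_of_lt_succ fun l => ?_, ?_, ?_⟩
  · simp only [hA]; ring
  · simp only [hB]; ring
  · exact Nat.mul_lt_mul_of_pos_left (by rw [hA]; omega) hpos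
  · exact Nat.mul_lt_mul_of_pos_left (by rw [hB]; omega) hpos
  · have h := isEquivalent_countNotSumThreeSquares i A 1 0 one_ne_zero ?_ ?_ ?_
    · simpa only [one_mul] using h
    · filter_upwards [hpow] with l hl
      have := hAc l
      omega
    · intro l
      have := hAc l
      omega
    · intro l
      rw [thueMorseDiscrepancy_of_recurrence_ten hA0 hA]
      simp
  · have h := isEquivalent_countNotSumThreeSquares i B (-1) 3 (by norm_num) ?_ ?_ ?_
    · simpa only [neg_one_mul] using h
    · filter_upwards [hpow] with l hl
      have := hBc l
      omega
    · intro l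
      have := hBc l
      omega
    · intro l
      have h1 := thueMorseDiscrepancy_of_recurrence_twenty hB0 hB l
      have h2 := abs_thueMorseDiscrepancy_succ_sub (B l)
      -- The discrepancy is known at `B l + 1`, where it is `-2l - 1`; stepping back to `B l` costs
      -- at most 2.
      have h3 : |thueMorseDiscrepancy (B l) - 2 * -1 * (l : ℤ)| ≤ 3 := by
        rw [h1] at h2
        rw [abs_le] at *
        omega
      exact_mod_cast h3
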